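/- Let $V$ be a complex Hilbert space with inner product $\langle\cdot,\cdot\rangle$ (antilinear in the first argument) and let $\overline{\,\cdot\,}$ be a continuous antilinear involution on $V$ with $\overline{\langle v,w\rangle}=\langle\overline v,\overline w\rangle$ for all $v,w\in V$. Let $V'_h$ be the real Banach space (with the operator norm) of all continuous linear functionals $\rho\colon V\to\mathbb C$ with $\overline{\rho(v)}=\rho(\overline v)$ for all $v\in V$. For every continuous positive semidefinite Hermitian form $\langle\cdot,\cdot\rangle_\alpha$ on $V$ let $\langle\cdot,\cdot\rangle_\alpha^\bullet$ be the positive Hermitian form on the algebraic tensor space $\mathcal T^\bullet(V)=\bigoplus_{k\ge 0}V^{\otimes k}$ for which tensors of different degrees are orthogonal and $$\langle x_1\otimes\cdots\otimes x_k,\;y_1\otimes\cdots\otimes y_k\rangle_\alpha^\bullet=k!\prod_{m=1}^k\langle x_m,y_m\rangle_\alpha .$$ Give $\mathcal T^\bullet(V)$ the locally convex topology of all the seminorms $X\mapsto\sqrt{\langle X,X\rangle_\alpha^\bullet}$. Let $\mathcal S^\bullet(V)\subseteq\mathcal T^\bullet(V)$ be the subspace of symmetric tensors, i.e. the image of the symmetrisation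 operator $x_1\otimes\cdots\otimes x_k\mapsto\frac1{k!}\sum_{\sigma\in\mathfrak S_k}x_{\sigma(1)}\otimes\cdots\otimes x_{\sigma(k)}$, with the subspace topology, and let $\mathcal S^\bullet(V)^{\mathrm{cpl}}$ be its completion. For $\rho\in V'_h$ let $D_\rho$ be the linear map on $\mathcal T^\bullet(V)$ that vanishes in degree $0$ and satisfies $D_\rho(x_1\otimes\cdots\otimes x_k)=k\,\rho(x_k)\,x_1\otimes\cdots\otimes x_{k-1}$ for $k\ge1$; let $\tau^*_\rho=\sum_{t\ge0}\frac1{t!}(D_\rho)^t$, and let $\delta_\rho(X)\in\mathbb C$ be the degree-$0$ component of $\tau^*_\rho(X)$. The functional $\delta_\rho$ is continuous; denote the continuous extension to $\mathcal S^\bullet(V)^{\mathrm{cpl}}$ of its restriction to $\mathcal S^\bullet(V)$ again by $\delta_\rho$. The Gel'fand transform of $X\in\mathcal S^\bullet(V)^{\mathrm{cpl}}$ is the function $\widehat X\colon V'_h\to\mathbb C$, $\widehat X(\rho)=\delta_\rho(X)$. Then for every $X\in\mathcal S^\bullet(V)^{\mathrm{cpl}}$ the function $\widehat X\colon V'_h\to\mathbb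 C$ is smooth in the Fréchet sense, i.e. infinitely often Fréchet differentiable on the real Banach space $V'_h$. -/

import Mathlib

noncomputable section

open scoped TensorProduct DirectSum Nat

namespace HilbertTensor

/-! ### Continuous positive Hermitian forms -/

/-- A continuous positive Hermitian form on a complex topological vector space `V`:
sesquilinear (antilinear in the first, linear in the second argument), Hermitian, positive
semidefinite, and jointly continuous. -/
structure PosHermForm (V : Type*) [AddCommGroup V] [Module ℂ V] [TopologicalSpace V] where
  form : V →ₗ⋆[ℂ] V →ₗ[ℂ] ℂ
  conj_symm : ∀ v w, (starRingEnd ℂ) (form w v) = form v w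
  nonneg : ∀ v, 0 ≤ (form v v).re
  continuous' : Continuous fun p : V × V => form p.1 p.2

/-! ### The tensor algebra and the extension of positive Hermitian forms -/

/-- The vector space `⨁ k, V^{⊗ k}` underlying the tensor algebra of `V`. -/
abbrev TensorSpace (V : Type*) [AddCommGroup V] [Module ℂ V] : Type _ :=
  ⨁ k : ℕ, ⨂[ℂ]^k V

section Algebraic

variable {V : Type*} [AddCommGroup V] [Module ℂ V]

/-- The inclusion of the tensors of degree `k`. -/
def incl (k : ℕ) : (⨂[ℂ]^k V) →ₗ[ℂ] TensorSpace V :=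
  DirectSum.lof ℂ ℕ (fun k => ⨂[ℂ]^k V) k

/-- The projection onto the tensors of degree `k`. -/
def proj (k : ℕ) : TensorSpace V →ₗ[ℂ] (⨂[ℂ]^k V) :=
  DirectSum.component ℂ ℕ (fun k => ⨂[ℂ]^k V) k

/-- The linear map on `⨁ k, V^{⊗ k}` given by linear maps on all the summands. -/
def ofDegrees {W : Type*} [AddCommGroup W] [Module ℂ W] (f : ∀ k : ℕ, (⨂[ℂ]^k V) →ₗ[ℂ] W) :
    TensorSpace V →ₗ[ℂ] W :=
  DirectSum.toModule ℂ ℕ W f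

theorem ofDegrees_incl {W : Type*} [AddCommGroup W] [Module ℂ W]
    (f : ∀ k : ℕ, (⨂[ℂ]^k V) →ₗ[ℂ] W) (k : ℕ) (x : ⨂[ℂ]^k V) :
    ofDegrees f (incl k x) = f k x :=
  by simp [ofDegrees, incl]

theorem proj_incl_self (k : ℕ) (x : ⨂[ℂ]^k V) : proj k (incl k x) = x :=
  by simp [proj, incl]

theorem proj_incl_ne {k l : ℕ} (h : k ≠ l) (x : ⨂[ℂ]^k V) : proj l (incl k x) = 0 := by
  simp only [proj, incl, DirectSum.component.of]
  rw [dif_neg h]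

theorem exists_sum_incl (X : TensorSpace V) :
    ∃ s : Finset ℕ, X = ∑ k ∈ s, incl k (proj k X) := by
  classical
  exact ⟨_, (DirectSum.sum_support_of (β := fun k : ℕ => ⨂[ℂ]^k V) X).symm⟩

theorem tensorSpace_induction {p : TensorSpace V → Prop} (X : TensorSpace V)
    (incl_tprod : ∀ k (x : Fin k → V), p (incl k (PiTensorProduct.tprod ℂ x)))
    (smul : ∀ (c : ℂ) X, p X → p (c • X)) (add : ∀ X Y, p X → p Y → p (X + Y)) : p X := by
  have h0 : p 0 := by
    simpa using smul 0 _ (incl_tprod 0 Fin.elim0)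
  have hk : ∀ k (x : ⨂[ℂ]^k V), p (incl k x) := by
    intro k x
    induction x using PiTensorProduct.induction_on with
    | smul_tprod r f => simpa using smul r _ (incl_tprod k f)
    | add x y hx hy => simpa using add _ _ hx hy
  obtain ⟨s, hs⟩ := exists_sum_incl X
  rw [hs]
  exact Finset.sum_induction _ p add h0 fun k _ => hk k _

/-- For linear functionals `η₁, …, η_k` on `V`, the linear functional on `V^{⊗ k}` with
`x₁ ⊗ ⋯ ⊗ x_k ↦ η₁ (x₁) ⋯ η_k (x_k)`. -/
def tensorFunctional (k : ℕ) :
    MultilinearMap ℂ (fun _ : Fin k => V →ₗ[ℂ] ℂ) ((⨂[ℂ]^k V) →ₗ[ℂ] ℂ) :=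
  (PiTensorProduct.lift (R := ℂ) (s := fun _ : Fin k => V) (E := ℂ)).toLinearMap.compMultilinearMap
    (MultilinearMap.piLinearMap (MultilinearMap.mkPiAlgebra ℂ (Fin k) ℂ))

theorem tensorFunctional_tprod (k : ℕ) (η : Fin k → V →ₗ[ℂ] ℂ) (x : Fin k → V) :
    tensorFunctional k η (PiTensorProduct.tprod ℂ x) = ∏ m, η m (x m) := by
  simp [tensorFunctional]

/-- For `y ∈ V^k`, the antilinear functional on `V^{⊗ k}` with
`x₁ ⊗ ⋯ ⊗ x_k ↦ k! ∏ₘ conj (α (yₘ, xₘ))`. -/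
def degreeFormAux (α : V →ₗ⋆[ℂ] V →ₗ[ℂ] ℂ) (k : ℕ) (y : Fin k → V) : (⨂[ℂ]^k V) →ₗ⋆[ℂ] ℂ where
  toFun X := k ! * (starRingEnd ℂ) (tensorFunctional k (fun m => α (y m)) X)
  map_add' X Y := by simp only [map_add, mul_add]
  map_smul' c X := by simp only [map_smul, smul_eq_mul, map_mul]; ring

/-- For Hermitian `α`, the sesquilinear form on `V^{⊗ k}` with
`⟨x₁ ⊗ ⋯ ⊗ x_k, y₁ ⊗ ⋯ ⊗ y_k⟩ = k! ∏ₘ α (xₘ, yₘ)`. -/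
def degreeForm (α : V →ₗ⋆[ℂ] V →ₗ[ℂ] ℂ) (k : ℕ) :
    (⨂[ℂ]^k V) →ₗ⋆[ℂ] (⨂[ℂ]^k V) →ₗ[ℂ] ℂ :=
  LinearMap.flip (PiTensorProduct.lift
    { toFun := degreeFormAux α k
      map_update_add' := by
        intro _ y m v w
        have h : ∀ u, (fun j => α (Function.update y m u j)) =
            Function.update (fun j => α (y j)) m (α u) := fun u => by
          ext1 j; rcases eq_or_ne j m with rfl | hj <;> simp [*]
        refine LinearMap.ext fun X => ?_
        simp only [degreeFormAux, LinearMap.coe_mk, AddHom.coe_mk, LinearMap.add_apply, h, map_add,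
          MultilinearMap.map_update_add, mul_add]
      map_update_smul' := by
        intro _ y m c v
        have h : ∀ u, (fun j => α (Function.update y m u j)) =
            Function.update (fun j => α (y j)) m (α u) := fun u => by
          ext1 j; rcases eq_or_ne j m with rfl | hj <;> simp [*]
        refine LinearMap.ext fun X => ?_
        simp only [degreeFormAux, LinearMap.coe_mk, AddHom.coe_mk, LinearMap.smul_apply, h,
          LinearMap.map_smulₛₗ, MultilinearMap.map_update_smul, smul_eq_mul, map_mul,
          Complex.conj_conj]
        ring })

theorem degreeForm_tprod (α : V →ₗ⋆[ℂ] V →ₗ[ℂ] ℂ) (hα : ∀ v w, (starRingEnd ℂ) (α w v) = α v w)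
    (k : ℕ) (x y : Fin k → V) :
    degreeForm α k (PiTensorProduct.tprod ℂ x) (PiTensorProduct.tprod ℂ y) =
      k ! * ∏ m, α (x m) (y m) := by
  simp [degreeForm, degreeFormAux, tensorFunctional_tprod, hα]

/-- The sesquilinear form `⟨X, Y⟩ = ∑ₖ ⟨Xₖ, Yₖ⟩` on `⨁ k, V^{⊗ k}`. -/
def tensorForm (α : V →ₗ⋆[ℂ] V →ₗ[ℂ] ℂ) : TensorSpace V →ₗ⋆[ℂ] TensorSpace V →ₗ[ℂ] ℂ :=
  LinearMap.flip (ofDegrees fun k => LinearMap.flip ((degreeForm α k).comp (proj k)))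

theorem tensorForm_incl (α : V →ₗ⋆[ℂ] V →ₗ[ℂ] ℂ) (k : ℕ) (X : TensorSpace V) (y : ⨂[ℂ]^k V) :
    tensorForm α X (incl k y) = degreeForm α k (proj k X) y := by
  simp [tensorForm, ofDegrees_incl]

theorem tensorForm_eq_sum (α : V →ₗ⋆[ℂ] V →ₗ[ℂ] ℂ) (X Y : TensorSpace V) (s : Finset ℕ)
    (hs : Y = ∑ k ∈ s, incl k (proj k Y)) :
    tensorForm α X Y = ∑ k ∈ s, degreeForm α k (proj k X) (proj k Y) := by
  conv_lhs => rw [hs]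
  simp only [map_sum, tensorForm_incl]

open scoped ComplexOrder in
theorem posSemidef_prod {ι : Type*} [Finite ι] (k : ℕ) (M : Fin k → Matrix ι ι ℂ)
    (hM : ∀ m, (M m).PosSemidef) :
    (Matrix.of fun i j => ∏ m, M m i j).PosSemidef := by
  induction k with
  | zero =>
    have h : (Matrix.of fun i j => ∏ m, M m i j) = Matrix.vecMulVec 1 (star 1) := by
      ext i j; simp [Matrix.vecMulVec_apply]
    rw [h]
    exact Matrix.posSemidef_vecMulVec_self_star _
  | succ k ih =>
    have h : (Matrix.of fun i j => ∏ m, M m i j) =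
        Matrix.hadamard (M 0) (Matrix.of fun i j => ∏ m : Fin k, M m.succ i j) := by
      ext i j; simp [Fin.prod_univ_succ]
    rw [h]
    exact (hM 0).hadamard (ih _ fun m => hM m.succ)

end Algebraic

section Topological

variable {V : Type*} [AddCommGroup V] [Module ℂ V] [TopologicalSpace V]

theorem degreeForm_conj_symm (α : PosHermForm V) (k : ℕ) (X Y : ⨂[ℂ]^k V) :
    (starRingEnd ℂ) (degreeForm α.form k Y X) = degreeForm α.form k X Y := by
  induction X using PiTensorProduct.induction_on with
  | smul_tprod r x =>
    induction Y using PiTensorProduct.induction_on with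
    | smul_tprod s y =>
      simp [LinearMap.map_smulₛₗ, degreeForm_tprod α.form α.conj_symm, α.conj_symm]
      ring
    | add Y Y' h h' => simp only [map_add, LinearMap.add_apply, h, h']
  | add X X' h h' => simp only [map_add, LinearMap.add_apply, h, h']

open scoped ComplexOrder in
theorem posSemidef_gram (α : PosHermForm V) {ι : Type*} [Fintype ι] (v : ι → V) :
    (Matrix.of fun i j => α.form (v i) (v j)).PosSemidef := by
  refine Matrix.PosSemidef.of_dotProduct_mulVec_nonneg ?_ fun a => ?_
  · ext i j
    simp [α.conj_symm]
  · have h : star a ⬝ᵥ (Matrix.of fun i j => α.form (v i) (v j)).mulVec a =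
        α.form (∑ i, a i • v i) (∑ i, a i • v i) := by
      simp only [dotProduct, Matrix.mulVec, Finset.mul_sum, LinearMap.map_smulₛₗ, map_sum,
        LinearMap.sum_apply, LinearMap.smul_apply, smul_eq_mul, Matrix.of_apply, Pi.star_apply,
        RCLike.star_def, RingHom.id_apply]
      rw [Finset.sum_comm]
      exact Finset.sum_congr rfl fun i _ => Finset.sum_congr rfl fun j _ => by ring
    rw [h, Complex.nonneg_iff]
    refine ⟨α.nonneg _, ?_⟩
    have := congrArg Complex.im (α.conj_symm (∑ i, a i • v i) (∑ i, a i • v i))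
    rw [Complex.conj_im] at this
    linarith

open scoped ComplexOrder in
theorem degreeForm_nonneg (α : PosHermForm V) (k : ℕ) (X : ⨂[ℂ]^k V) :
    0 ≤ (degreeForm α.form k X X).re := by
  classical
  have hX : X ∈ Submodule.span ℂ (Set.range (PiTensorProduct.tprod ℂ (s := fun _ : Fin k => V))) := by
    rw [PiTensorProduct.span_tprod_eq_top]; trivial
  obtain ⟨c, rfl⟩ := Finsupp.mem_span_range_iff_exists_finsupp.1 hX
  have h := (posSemidef_prod k _ fun m =>
    posSemidef_gram α fun x : c.support => (x : Fin k → V) m).dotProduct_mulVec_nonneg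
      fun x => c x
  have h2 : degreeForm α.form k (c.sum fun x a => a • PiTensorProduct.tprod ℂ x)
      (c.sum fun x a => a • PiTensorProduct.tprod ℂ x) = k ! * (star (fun x : c.support => c x) ⬝ᵥ
      (Matrix.of fun i j : c.support => ∏ m,
        (Matrix.of fun i j : c.support => α.form (i.1 m) (j.1 m)) i j).mulVec fun x => c x) := by
    rw [Finsupp.sum, ← Finset.sum_attach]
    simp only [dotProduct, Matrix.mulVec, Finset.mul_sum, LinearMap.map_smulₛₗ, map_sum,
      LinearMap.sum_apply, LinearMap.smul_apply, smul_eq_mul, Matrix.of_apply, Pi.star_apply,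
      RCLike.star_def, RingHom.id_apply, degreeForm_tprod α.form α.conj_symm]
    rw [Finset.sum_comm]
    exact Finset.sum_congr rfl fun i _ => Finset.sum_congr rfl fun j _ => by ring
  rw [h2]
  have h3 : (0 : ℂ) ≤ (k ! : ℂ) := by positivity
  exact (Complex.nonneg_iff.1 (mul_nonneg h3 h)).1

theorem tensorForm_conj_symm (α : PosHermForm V) (X Y : TensorSpace V) :
    (starRingEnd ℂ) (tensorForm α.form Y X) = tensorForm α.form X Y := by
  obtain ⟨s, hs⟩ := exists_sum_incl X
  obtain ⟨t, ht⟩ := exists_sum_incl Y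
  have key : ∀ (i j : ℕ) (x : ⨂[ℂ]^i V) (y : ⨂[ℂ]^j V),
      (starRingEnd ℂ) (tensorForm α.form (incl j y) (incl i x)) =
        tensorForm α.form (incl i x) (incl j y) := by
    intro i j x y
    rw [tensorForm_incl, tensorForm_incl]
    rcases eq_or_ne i j with rfl | h
    · rw [proj_incl_self, proj_incl_self, degreeForm_conj_symm]
    · rw [proj_incl_ne h, proj_incl_ne h.symm]; simp
  rw [hs, ht]
  simp only [map_sum, LinearMap.sum_apply, key]
  exact Finset.sum_comm

theorem tensorForm_nonneg (α : PosHermForm V) (X : TensorSpace V) :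
    0 ≤ (tensorForm α.form X X).re := by
  obtain ⟨s, hs⟩ := exists_sum_incl X
  rw [tensorForm_eq_sum α.form X X s hs, Complex.re_sum]
  exact Finset.sum_nonneg fun k _ => degreeForm_nonneg α k _

/-- The positive Hermitian form extending `α` to `⨁ k, V^{⊗ k}`, as a semi-inner product. -/
@[reducible] def tensorCore (α : PosHermForm V) : PreInnerProductSpace.Core ℂ (TensorSpace V) where
  inner X Y := tensorForm α.form X Y
  conj_inner_symm := tensorForm_conj_symm α
  re_inner_nonneg := tensorForm_nonneg α
  add_left X Y Z := by simp
  smul_left X Y r := by simp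

/-- The seminorm `‖X‖ = √⟨X, X⟩` on `⨁ k, V^{⊗ k}` given by the extension of `α`. -/
def tensorSeminorm (α : PosHermForm V) : Seminorm ℂ (TensorSpace V) :=
  Seminorm.of (fun X => √(tensorForm α.form X X).re)
    (by
      let := tensorCore α
      let := InnerProductSpace.Core.toSeminormedAddCommGroup (𝕜 := ℂ) (F := TensorSpace V)
      exact fun X Y => norm_add_le X Y)
    (by
      let := tensorCore α
      let := InnerProductSpace.Core.toSeminormedAddCommGroup (𝕜 := ℂ) (F := TensorSpace V)
      let := InnerProductSpace.Core.toNormedSpace (𝕜 := ℂ) (F := TensorSpace V)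
      exact fun a X => norm_smul a X)

theorem tensorSeminorm_apply (α : PosHermForm V) (X : TensorSpace V) :
    tensorSeminorm α X = √(tensorForm α.form X X).re := rfl

/-- The locally convex (uniform) structure on `⨁ k, V^{⊗ k}` defined by the seminorms that come
from all continuous positive Hermitian forms on `V`. -/
instance : UniformSpace (TensorSpace V) :=
  ⨅ α : PosHermForm V, (tensorSeminorm α).toSeminormedAddCommGroup.toUniformSpace

instance : IsUniformAddGroup (TensorSpace V) :=
  isUniformAddGroup_iInf fun α =>
    @SeminormedAddCommGroup.to_isUniformAddGroup _ (tensorSeminorm α).toSeminormedAddCommGroup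

end Topological

/-! ### Symmetric tensors -/

section Symmetric

variable (V : Type*) [AddCommGroup V] [Module ℂ V]

/-- The symmetrisation of tensors of degree `k`,
`x₁ ⊗ ⋯ ⊗ x_k ↦ (1 / k!) ∑_σ x_{σ 1} ⊗ ⋯ ⊗ x_{σ k}`. -/
def symmDegree (k : ℕ) : (⨂[ℂ]^k V) →ₗ[ℂ] (⨂[ℂ]^k V) :=
  (k ! : ℂ)⁻¹ • ∑ σ : Equiv.Perm (Fin k), PiTensorProduct.lift
    ((PiTensorProduct.tprod ℂ (s := fun _ : Fin k => V)).domDomCongr σ)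

/-- The symmetrisation operator on `⨁ k, V^{⊗ k}`. -/
def symmetrisation : TensorSpace V →ₗ[ℂ] TensorSpace V :=
  ofDegrees fun k => incl k ∘ₗ symmDegree V k

/-- The space of symmetric tensors, the image of the symmetrisation operator. With `V` a
topological vector space, it carries the subspace topology and uniformity. -/
def SymTensor : Submodule ℂ (TensorSpace V) := LinearMap.range (symmetrisation V)

instance [TopologicalSpace V] : IsUniformAddGroup (SymTensor V) :=
  (SymTensor V).toAddSubgroup.isUniformAddGroup

/-- The completion of the locally convex space of symmetric tensors. -/
abbrev SymTensorCpl [TopologicalSpace V] : Type _ :=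
  UniformSpace.Completion (SymTensor V)

end Symmetric

/-! ### Derivative, translation and evaluation -/

section Evaluation

variable {V : Type*} [AddCommGroup V] [Module ℂ V]

/-- The degree `k` part of the derivative in direction `ρ`: zero for `k = 0`, and
`x₁ ⊗ ⋯ ⊗ x_k ↦ k ρ(x_k) x₁ ⊗ ⋯ ⊗ x_{k-1}` for `k > 0`. -/
def derivDegree (ρ : V →ₗ[ℂ] ℂ) : ∀ k : ℕ, (⨂[ℂ]^k V) →ₗ[ℂ] TensorSpace V
  | 0 => 0
  | k + 1 => incl k ∘ₗ PiTensorProduct.lift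
      (((k + 1 : ℂ) • LinearMap.smulRightₗ ρ).compMultilinearMap
        (PiTensorProduct.tprod ℂ (s := fun _ : Fin k => V))).uncurryRight

/-- The derivative `D_ρ` in direction `ρ`. -/
def tensorDeriv (ρ : V →ₗ[ℂ] ℂ) : Module.End ℂ (TensorSpace V) :=
  ofDegrees (derivDegree ρ)

theorem tensorDeriv_zero (ρ : V →ₗ[ℂ] ℂ) (x : ⨂[ℂ]^0 V) : tensorDeriv ρ (incl 0 x) = 0 := by
  rw [tensorDeriv, ofDegrees_incl]; rfl

theorem tensorDeriv_succ (ρ : V →ₗ[ℂ] ℂ) (k : ℕ) (x : Fin (k + 1) → V) :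
    tensorDeriv ρ (incl (k + 1) (PiTensorProduct.tprod ℂ x)) =
      ((k + 1 : ℂ) * ρ (x (Fin.last k))) •
        incl k (PiTensorProduct.tprod ℂ fun i : Fin k => x i.castSucc) := by
  rw [tensorDeriv, ofDegrees_incl]
  simp [derivDegree, mul_smul, Fin.init_def]

theorem tensorDeriv_pow (ρ : V →ₗ[ℂ] ℂ) (k t : ℕ) (h : k < t) (x : ⨂[ℂ]^k V) :
    (tensorDeriv ρ ^ t) (incl k x) = 0 := by
  induction k generalizing t with
  | zero =>
    obtain ⟨t, rfl⟩ := Nat.exists_eq_add_of_lt h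
    simp [pow_succ, tensorDeriv_zero]
  | succ k ih =>
    obtain ⟨t, rfl⟩ : ∃ s, t = s + 1 := ⟨t - 1, by omega⟩
    induction x using PiTensorProduct.induction_on with
    | smul_tprod r x =>
      simp only [map_smul, pow_succ, Module.End.mul_apply, tensorDeriv_succ,
        ih t (by omega), smul_zero]
    | add X X' h h' => simp only [map_add, h, h', add_zero]

/-- The translation `τ*_ρ = ∑ₜ (1 / t!) (D_ρ)^t`. On tensors of degree `k`, the terms with `t > k`
vanish. -/
def translation (ρ : V →ₗ[ℂ] ℂ) : TensorSpace V →ₗ[ℂ] TensorSpace V :=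
  ofDegrees fun k => ∑ t ∈ Finset.range (k + 1), (t ! : ℂ)⁻¹ • ((tensorDeriv ρ ^ t) ∘ₗ incl k)

theorem translation_apply (ρ : V →ₗ[ℂ] ℂ) (X : TensorSpace V) :
    translation ρ X = ∑ᶠ t : ℕ, (t ! : ℂ)⁻¹ • (tensorDeriv ρ ^ t) X := by
  obtain ⟨s, hs⟩ := exists_sum_incl X
  have hlt : ∀ k ∈ s, k < s.sup id + 1 := fun k hk =>
    Nat.lt_succ_of_le (Finset.le_sup (f := id) hk)
  have h0 : ∀ t, s.sup id + 1 ≤ t → (tensorDeriv ρ ^ t) X = 0 := fun t ht => by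
    rw [hs, map_sum]
    exact Finset.sum_eq_zero fun k hk => tensorDeriv_pow ρ k t ((hlt k hk).trans_le ht) _
  rw [finsum_eq_sum_of_support_subset (s := Finset.range (s.sup id + 1))]
  · conv_lhs => rw [hs]
    conv_rhs => rw [hs]
    simp only [map_sum, Finset.smul_sum]
    rw [Finset.sum_comm]
    refine Finset.sum_congr rfl fun k hk => ?_
    rw [translation, ofDegrees_incl]
    simp only [LinearMap.sum_apply, LinearMap.smul_apply, LinearMap.comp_apply]
    refine Finset.sum_subset (Finset.range_subset_range.2 (hlt k hk)) fun t _ ht => ?_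
    rw [tensorDeriv_pow ρ k t (by simpa using ht), smul_zero]
  · intro t ht
    by_contra hn
    exact ht (by
      change (t ! : ℂ)⁻¹ • (tensorDeriv ρ ^ t) X = 0
      rw [h0 t (by simpa using hn), smul_zero])

/-- The evaluation at `ρ`, `δ_ρ = ⟨·⟩₀ ∘ τ*_ρ`, with the tensors of degree `0` identified with
`ℂ`. -/
def evalAt (ρ : V →ₗ[ℂ] ℂ) : TensorSpace V →ₗ[ℂ] ℂ :=
  (PiTensorProduct.isEmptyEquiv (Fin 0)).toLinearMap ∘ₗ proj 0 ∘ₗ translation ρ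

theorem proj_tensorDeriv_pow (ρ : V →ₗ[ℂ] ℂ) (k t : ℕ) (h : t < k) (x : Fin k → V) :
    proj 0 ((tensorDeriv ρ ^ t) (incl k (PiTensorProduct.tprod ℂ x))) = 0 := by
  induction t generalizing k with
  | zero => simpa using proj_incl_ne (by omega) _
  | succ t ih =>
    obtain ⟨k, rfl⟩ : ∃ l, k = l + 1 := ⟨k - 1, by omega⟩
    rw [pow_succ, Module.End.mul_apply, tensorDeriv_succ, map_smul, map_smul, ih k (by omega),
      smul_zero]

theorem tensorDeriv_pow_self (ρ : V →ₗ[ℂ] ℂ) (k : ℕ) (x : Fin k → V) :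
    (tensorDeriv ρ ^ k) (incl k (PiTensorProduct.tprod ℂ x)) =
      ((k ! : ℂ) * ∏ m, ρ (x m)) • incl 0 (PiTensorProduct.tprod ℂ Fin.elim0) := by
  induction k with
  | zero => simp [Subsingleton.elim x Fin.elim0]
  | succ k ih =>
    rw [pow_succ, Module.End.mul_apply, tensorDeriv_succ, map_smul, ih, smul_smul,
      Fin.prod_univ_castSucc, Nat.factorial_succ]
    push_cast
    congr 1
    ring

theorem evalAt_incl (ρ : V →ₗ[ℂ] ℂ) (k : ℕ) (x : ⨂[ℂ]^k V) :
    evalAt ρ (incl k x) = tensorFunctional k (fun _ => ρ) x := by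
  induction x using PiTensorProduct.induction_on with
  | smul_tprod r x =>
    rw [map_smul, map_smul, map_smul, tensorFunctional_tprod]
    congr 1
    simp only [evalAt, translation, LinearMap.comp_apply, ofDegrees_incl, LinearMap.sum_apply,
      LinearMap.smul_apply, map_sum, map_smul]
    rw [Finset.sum_range_succ, Finset.sum_eq_zero fun t ht => by
      rw [proj_tensorDeriv_pow ρ k t (Finset.mem_range.1 ht), map_zero, smul_zero],
      tensorDeriv_pow_self, map_smul, proj_incl_self]
    have hk : (k ! : ℂ) ≠ 0 := by exact_mod_cast k.factorial_ne_zero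
    simp [hk]
  | add x y hx hy => simp only [map_add, hx, hy]

end Evaluation

section Gelfand

variable {V : Type*} [AddCommGroup V] [Module ℂ V] [TopologicalSpace V]

/-- The positive Hermitian form `(v, w) ↦ conj (ρ v) ρ w`. -/
def rankOne (ρ : V →L[ℂ] ℂ) : PosHermForm V where
  form := LinearMap.mk₂'ₛₗ (starRingEnd ℂ) (RingHom.id ℂ) (fun v w => (starRingEnd ℂ) (ρ v) * ρ w)
    (by intros; simp [add_mul]) (by intros; simp [mul_assoc]) (by intros; simp [mul_add])
    (by intros; simp; ring)
  conj_symm v w := by simp [mul_comm]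
  nonneg v := by
    simp only [LinearMap.mk₂'ₛₗ_apply, mul_comm, Complex.mul_conj, Complex.ofReal_re]
    exact Complex.normSq_nonneg _
  continuous' := by
    simp only [LinearMap.mk₂'ₛₗ_apply]
    exact (Complex.continuous_conj.comp (ρ.continuous.comp continuous_fst)).mul
      (ρ.continuous.comp continuous_snd)

theorem degreeForm_rankOne (ρ : V →L[ℂ] ℂ) (k : ℕ) (X Y : ⨂[ℂ]^k V) :
    degreeForm (rankOne ρ).form k X Y = k ! *
      ((starRingEnd ℂ) (tensorFunctional k (fun _ => (ρ : V →ₗ[ℂ] ℂ)) X) *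
        tensorFunctional k (fun _ => (ρ : V →ₗ[ℂ] ℂ)) Y) := by
  induction X using PiTensorProduct.induction_on with
  | smul_tprod r x =>
    induction Y using PiTensorProduct.induction_on with
    | smul_tprod s y =>
      simp only [map_smul, LinearMap.map_smulₛₗ, LinearMap.smul_apply, smul_eq_mul, map_mul,
        degreeForm_tprod _ (rankOne ρ).conj_symm, tensorFunctional_tprod, map_prod]
      simp only [rankOne, LinearMap.mk₂'ₛₗ_apply, Finset.prod_mul_distrib,
        ContinuousLinearMap.coe_coe]
      ring
    | add Y Y' h h' => simp only [map_add, h, h', mul_add]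
  | add X X' h h' => simp only [map_add, LinearMap.add_apply, h, h', mul_add, add_mul]

/-- The functional `δ_ρ` is continuous for every continuous `ρ`. -/
theorem exists_norm_evalAt_le (ρ : V →L[ℂ] ℂ) : ∃ C : ℝ, 0 ≤ C ∧ ∀ X : TensorSpace V,
    ‖evalAt (ρ : V →ₗ[ℂ] ℂ) X‖ ≤ C * tensorSeminorm (rankOne ρ) X := by
  have hsum : Summable fun k : ℕ => ((k ! : ℝ))⁻¹ := by
    simpa using Real.summable_pow_div_factorial 1
  have hC : 0 ≤ ∑' k : ℕ, ((k ! : ℝ))⁻¹ := tsum_nonneg fun k => by positivity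
  refine ⟨√(∑' k : ℕ, ((k ! : ℝ))⁻¹), Real.sqrt_nonneg _, fun X => ?_⟩
  obtain ⟨s, hs⟩ := exists_sum_incl X
  set a : ℕ → ℂ := fun k => tensorFunctional k (fun _ => (ρ : V →ₗ[ℂ] ℂ)) (proj k X) with ha
  have h1 : evalAt (ρ : V →ₗ[ℂ] ℂ) X = ∑ k ∈ s, a k := by
    conv_lhs => rw [hs]
    simp only [map_sum, evalAt_incl, ha]
  have h2 : (tensorForm (rankOne ρ).form X X).re = ∑ k ∈ s, k ! * ‖a k‖ ^ 2 := by
    rw [tensorForm_eq_sum _ X X s hs, Complex.re_sum]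
    refine Finset.sum_congr rfl fun k _ => ?_
    rw [degreeForm_rankOne, mul_comm ((starRingEnd ℂ) _), Complex.mul_conj, ← Complex.sq_norm]
    norm_cast
  rw [tensorSeminorm_apply, ← Real.sqrt_mul hC, h1, h2]
  refine Real.le_sqrt_of_sq_le ?_
  calc ‖∑ k ∈ s, a k‖ ^ 2 ≤ (∑ k ∈ s, ‖a k‖) ^ 2 := by
        gcongr; exact norm_sum_le _ _
    _ ≤ (∑ k ∈ s, ((k ! : ℝ))⁻¹) * ∑ k ∈ s, k ! * ‖a k‖ ^ 2 := by
        refine Finset.sum_sq_le_sum_mul_sum_of_sq_le_mul _ (fun k _ => by positivity)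
          (fun k _ => by positivity) fun k _ => le_of_eq ?_
        have : (k ! : ℝ) ≠ 0 := by exact_mod_cast k.factorial_ne_zero
        field_simp
    _ ≤ _ := by
        gcongr
        exact hsum.sum_le_tsum _ fun k _ => by positivity

theorem uniformContinuous_evalAt (ρ : V →L[ℂ] ℂ) :
    UniformContinuous (evalAt (ρ : V →ₗ[ℂ] ℂ)) := by
  obtain ⟨C, hC, h⟩ := exists_norm_evalAt_le ρ
  refine uniformContinuous_iInf_dom (i := rankOne ρ) ?_
  let := (tensorSeminorm (rankOne ρ)).toSeminormedAddCommGroup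
  exact AddMonoidHomClass.uniformContinuous_of_bound (evalAt (ρ : V →ₗ[ℂ] ℂ)) C h

/-- The Hermitian elements `V'_h` of the topological dual of `V`, with respect to an antilinear
map `J` on `V` (the involution): the real vector space of all continuous linear functionals `ρ`
with `conj (ρ v) = ρ (J v)`. -/
def hermDual (J : V →L⋆[ℂ] V) : Submodule ℝ (V →L[ℂ] ℂ) where
  carrier := {ρ | ∀ v, (starRingEnd ℂ) (ρ v) = ρ (J v)}
  add_mem' h h' v := by simp [h v, h' v]
  zero_mem' v := by simp
  smul_mem' c ρ h v := by simp [h v]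

/-- The Gel'fand transform `X̂` of an element `X` of the completion of the symmetric tensors: the
function on `V'_h` that maps `ρ` to the value at `X` of the continuous extension of `δ_ρ`. -/
def gelfand (J : V →L⋆[ℂ] V) (X : SymTensorCpl V) (ρ : hermDual J) : ℂ :=
  UniformSpace.Completion.extension
    (fun Y : SymTensor V => evalAt ((ρ : V →L[ℂ] ℂ) : V →ₗ[ℂ] ℂ) Y) X

theorem gelfand_coe (J : V →L⋆[ℂ] V) (Y : SymTensor V) (ρ : hermDual J) :
    gelfand J Y ρ = evalAt ((ρ : V →L[ℂ] ℂ) : V →ₗ[ℂ] ℂ) Y :=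
  UniformSpace.Completion.extension_coe
    ((uniformContinuous_evalAt (ρ : V →L[ℂ] ℂ)).comp uniformContinuous_subtype_val) Y

theorem continuous_gelfand (J : V →L⋆[ℂ] V) (ρ : hermDual J) :
    Continuous fun X : SymTensorCpl V => gelfand J X ρ :=
  UniformSpace.Completion.continuous_extension

end Gelfand

end HilbertTensor

/-!
For a tensor `X`, the function `ρ ↦ δ_ρ X` is the polynomial `∑ₖ ρ^{⊗ k} Xₖ`, and Cauchy–Schwarz
together with the Riesz representation of `ρ` gives `‖ρ^{⊗ k} Xₖ‖ ≤ ‖X‖ ‖ρ‖ᵏ / √k!`, with `‖X‖` the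
seminorm coming from the inner product of `V`. Since `∑ₖ rᵏ / √k!` converges for all `r`, this bound
survives the passage to the completion: there the function becomes a power series with infinite
radius of convergence on the whole dual of `V`, and `V'_h` is a real subspace of that dual.
-/

namespace HilbertTensor

theorem summable_pow_div_sqrt_factorial (x : ℝ) : Summable fun k : ℕ => x ^ k / √(k ! : ℝ) := by
  have hexp : Summable fun k : ℕ => (4 * x ^ 2) ^ k / (k ! : ℝ) :=
    Real.summable_pow_div_factorial _
  have hgeom : Summable fun k : ℕ => (1 / 4 : ℝ) ^ k :=
    summable_geometric_of_lt_one (by norm_num) (by norm_num)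
  refine Summable.of_norm_bounded (hexp.add hgeom) fun k => ?_
  -- AM-GM for the factors `(2 |x|)ᵏ / √k!` and `2⁻ᵏ`, whose squares are both summable
  set a : ℝ := (2 * |x|) ^ k / √(k ! : ℝ) with ha
  set b : ℝ := (1 / 2) ^ k with hb
  have hprod : ‖x ^ k / √(k ! : ℝ)‖ = a * b := by
    rw [norm_div, norm_pow, Real.norm_eq_abs, Real.norm_of_nonneg (Real.sqrt_nonneg _), ha, hb,
      div_mul_eq_mul_div, ← mul_pow]
    congr 2
    ring
  have ha_sq : a ^ 2 = (4 * x ^ 2) ^ k / (k ! : ℝ) := by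
    rw [ha, div_pow, Real.sq_sqrt (by positivity), pow_right_comm, mul_pow, sq_abs]
    norm_num
  have hb_sq : b ^ 2 = (1 / 4) ^ k := by
    rw [hb, pow_right_comm]
    norm_num
  have hab : 0 ≤ a * b := by positivity
  rw [hprod, ← ha_sq, ← hb_sq]
  linarith [two_mul_le_add_sq a b]

theorem hasSum_of_denseRange_of_norm_le {ι D E F : Type*} [TopologicalSpace E]
    [SeminormedAddCommGroup F] {i : D → E} (hi : DenseRange i) {f : ι → E → F} {g : E → F}
    {B : E → ℝ} {u : ι → ℝ} (hf : ∀ k, Continuous (f k)) (hg : Continuous g) (hB : Continuous B)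
    (hu : Summable u) (hle : ∀ k d, ‖f k (i d)‖ ≤ B (i d) * u k)
    (hsum : ∀ d, HasSum (fun k => f k (i d)) (g (i d))) (x : E) :
    HasSum (fun k => f k x) (g x) := by
  have remainder_le (s : Finset ι) :
      ‖g x - ∑ k ∈ s, f k x‖ ≤ B x * ∑' k : { k // k ∉ s }, u k := by
    induction x using isClosed_property hi with
    | hp =>
      exact isClosed_le (hg.sub (continuous_finsetSum s fun k _ => hf k)).norm (hB.mul_const _)
    | h d =>
      have htail : HasSum (fun k : { k // k ∉ s } => f k (i d)) (g (i d) - ∑ k ∈ s, f k (i d)) :=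
        s.hasSum_iff_compl.1 (hsum d)
      exact htail.norm_le_of_bounded ((hu.subtype _).hasSum.mul_left _) fun k => hle k d
  rw [HasSum, SummationFilter.unconditional_filter, tendsto_iff_norm_sub_tendsto_zero]
  refine squeeze_zero (fun _ => norm_nonneg _) (fun s => ?_)
    (by simpa only [mul_zero] using (tendsto_tsum_compl_atTop_zero u).const_mul (B x))
  rw [norm_sub_rev]
  exact remainder_le s

section TensorFunctional

variable {V : Type*} [AddCommGroup V] [Module ℂ V]

theorem hasSum_evalAt (ρ : V →ₗ[ℂ] ℂ) (X : TensorSpace V) :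
    HasSum (fun k => tensorFunctional k (fun _ => ρ) (proj k X)) (evalAt ρ X) := by
  obtain ⟨s, hs⟩ := exists_sum_incl X
  have heval : evalAt ρ X = ∑ k ∈ s, tensorFunctional k (fun _ => ρ) (proj k X) := by
    conv_lhs => rw [hs]
    simp only [map_sum, evalAt_incl]
  have hproj : ∀ k ∉ s, proj k X = 0 := fun k hk => by
    rw [hs, map_sum]
    exact Finset.sum_eq_zero fun l hl => proj_incl_ne (ne_of_mem_of_not_mem hl hk) _
  rw [heval]
  exact hasSum_sum_of_ne_finset_zero fun k hk => by rw [hproj k hk, map_zero]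

theorem exists_finiteDimensional_tensorFunctional_congr (k : ℕ) (X : ⨂[ℂ]^k V) :
    ∃ F : Submodule ℂ V, FiniteDimensional ℂ F ∧ ∀ η θ : Fin k → V →ₗ[ℂ] ℂ,
      (∀ m, ∀ v ∈ F, η m v = θ m v) → tensorFunctional k η X = tensorFunctional k θ X := by
  induction X using PiTensorProduct.induction_on with
  | smul_tprod r x =>
    refine ⟨Submodule.span ℂ (Set.range x), .span_of_finite ℂ (Set.finite_range x),
      fun η θ h => ?_⟩
    simp only [map_smul, tensorFunctional_tprod,
      fun m => h m (x m) (Submodule.subset_span (Set.mem_range_self m))]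
  | add X Y hX hY =>
    obtain ⟨F, _, hF⟩ := hX
    obtain ⟨G, _, hG⟩ := hY
    refine ⟨F ⊔ G, inferInstance, fun η θ h => ?_⟩
    rw [map_add, map_add, hF η θ fun m v hv => h m v (Submodule.mem_sup_left hv),
      hG η θ fun m v hv => h m v (Submodule.mem_sup_right hv)]

end TensorFunctional

section TensorSeminorm

variable {V : Type*} [AddCommGroup V] [Module ℂ V] [TopologicalSpace V]

theorem PosHermForm.coe_re_form_self (α : PosHermForm V) (v : V) :
    ((α.form v v).re : ℂ) = α.form v v :=
  Complex.conj_eq_iff_re.1 (α.conj_symm v v)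

theorem tensorForm_incl_tprod_left (α : PosHermForm V) (k : ℕ) (x : Fin k → V)
    (Y : TensorSpace V) :
    tensorForm α.form (incl k (PiTensorProduct.tprod ℂ x)) Y =
      k ! * tensorFunctional k (fun m => α.form (x m)) (proj k Y) := by
  rw [← tensorForm_conj_symm, tensorForm_incl]
  simp [degreeForm, degreeFormAux]

theorem norm_tensorForm_le (α : PosHermForm V) (X Y : TensorSpace V) :
    ‖tensorForm α.form X Y‖ ≤ tensorSeminorm α X * tensorSeminorm α Y := by
  let := tensorCore α
  exact InnerProductSpace.Core.norm_inner_le_norm (𝕜 := ℂ) X Y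

theorem tensorSeminorm_incl_tprod (α : PosHermForm V) (k : ℕ) (x : Fin k → V) :
    tensorSeminorm α (incl k (PiTensorProduct.tprod ℂ x)) =
      √(k ! : ℝ) * ∏ m, √(α.form (x m) (x m)).re := by
  have hself : tensorForm α.form (incl k (PiTensorProduct.tprod ℂ x))
      (incl k (PiTensorProduct.tprod ℂ x)) = ((k ! * ∏ m, (α.form (x m) (x m)).re : ℝ) : ℂ) := by
    rw [tensorForm_incl_tprod_left, proj_incl_self, tensorFunctional_tprod]
    push_cast
    simp only [α.coe_re_form_self]
  rw [tensorSeminorm_apply, hself, Complex.ofReal_re, Real.sqrt_mul (by positivity),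
    Real.sqrt_prod _ fun m _ => α.nonneg (x m)]

theorem norm_tensorFunctional_form_le (α : PosHermForm V) (k : ℕ) (x : Fin k → V)
    (X : TensorSpace V) :
    ‖tensorFunctional k (fun m => α.form (x m)) (proj k X)‖ ≤
      tensorSeminorm α X / √(k ! : ℝ) * ∏ m, √(α.form (x m) (x m)).re := by
  have hk : 0 < √(k ! : ℝ) := by positivity
  have cauchy_schwarz := norm_tensorForm_le α (incl k (PiTensorProduct.tprod ℂ x)) X
  rw [tensorForm_incl_tprod_left, tensorSeminorm_incl_tprod, norm_mul, Complex.norm_natCast,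
    mul_assoc] at cauchy_schwarz
  rw [div_mul_eq_mul_div, le_div_iff₀ hk, mul_comm, mul_comm (tensorSeminorm α X)]
  refine le_of_mul_le_mul_left ?_ hk
  rwa [← mul_assoc, Real.mul_self_sqrt (by positivity)]

theorem uniformContinuous_of_norm_le_tensorSeminorm {E : Type*} [SeminormedAddCommGroup E]
    (α : PosHermForm V) (f : TensorSpace V →+ E) (C : ℝ)
    (hf : ∀ X, ‖f X‖ ≤ C * tensorSeminorm α X) : UniformContinuous f := by
  refine uniformContinuous_iInf_dom (i := α) ?_
  let := (tensorSeminorm α).toSeminormedAddCommGroup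
  exact AddMonoidHomClass.uniformContinuous_of_bound f C hf

theorem uniformContinuous_tensorSeminorm (α : PosHermForm V) :
    UniformContinuous (tensorSeminorm α) := by
  refine uniformContinuous_iInf_dom (i := α) ?_
  let := (tensorSeminorm α).toSeminormedAddCommGroup
  exact uniformContinuous_norm

end TensorSeminorm

section Extension

variable {V : Type*} [AddCommGroup V] [Module ℂ V] [TopologicalSpace V]
  {E : Type*} [UniformSpace E]

/-- The continuous extension to the completion of the restriction of `f` to the symmetric tensors.
It is a junk value unless this restriction is uniformly continuous. -/
def extendCpl (f : TensorSpace V → E) : SymTensorCpl V → E :=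
  UniformSpace.Completion.extension fun Y : SymTensor V => f Y

theorem extendCpl_coe [T0Space E] {f : TensorSpace V → E} (hf : UniformContinuous f)
    (Y : SymTensor V) :
    extendCpl f Y = f Y :=
  UniformSpace.Completion.extension_coe (hf.comp uniformContinuous_subtype_val) Y

theorem continuous_extendCpl [CompleteSpace E] (f : TensorSpace V → E) :
    Continuous (extendCpl f) :=
  UniformSpace.Completion.continuous_extension

end Extension

section PowerSeries

variable {V : Type*} [NormedAddCommGroup V] [InnerProductSpace ℂ V]

variable (V) in
/-- The inner product of `V` as a continuous positive Hermitian form. -/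
def innerForm : PosHermForm V where
  form := innerₛₗ ℂ
  conj_symm v w := by simp
  nonneg v := by simpa using inner_self_nonneg (𝕜 := ℂ) (x := v)
  continuous' := by simpa using continuous_inner (𝕜 := ℂ) (E := V)

theorem sqrt_re_innerForm_self (v : V) : √((innerForm V).form v v).re = ‖v‖ :=
  (norm_eq_sqrt_re_inner (𝕜 := ℂ) v).symm

theorem exists_norm_le_inner_eq_on (F : Submodule ℂ V) [FiniteDimensional ℂ F] (η : V →L[ℂ] ℂ) :
    ∃ r : V, ‖r‖ ≤ ‖η‖ ∧ ∀ v ∈ F, inner ℂ r v = η v := by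
  refine ⟨(InnerProductSpace.toDual ℂ F).symm (η ∘L F.subtypeL), ?_, fun v hv => ?_⟩
  · rw [← Submodule.coe_norm, LinearIsometryEquiv.norm_map]
    exact η.opNorm_comp_le F.subtypeL |>.trans
      (mul_le_of_le_one_right (norm_nonneg _) F.norm_subtypeL_le)
  · exact InnerProductSpace.toDual_symm_apply (x := (⟨v, hv⟩ : F)) (y := η ∘L F.subtypeL)

-- A tensor involves only a finite-dimensional subspace, on which the Riesz representation does not
-- require `V` to be complete.
theorem norm_tensorFunctional_proj_le (k : ℕ) (η : Fin k → V →L[ℂ] ℂ) (X : TensorSpace V) :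
    ‖tensorFunctional k (fun m => (η m : V →ₗ[ℂ] ℂ)) (proj k X)‖ ≤
      tensorSeminorm (innerForm V) X / √(k ! : ℝ) * ∏ m, ‖η m‖ := by
  obtain ⟨F, _, hF⟩ := exists_finiteDimensional_tensorFunctional_congr k (proj k X)
  choose r hr_norm hr_inner using fun m => exists_norm_le_inner_eq_on F (η m)
  rw [hF _ (fun m => (innerForm V).form (r m)) fun m v hv => (hr_inner m v hv).symm]
  refine (norm_tensorFunctional_form_le (innerForm V) k r X).trans ?_
  simp only [sqrt_re_innerForm_self]
  gcongr with m
  exact hr_norm m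

/-- The homogeneous part of degree `k` of the function `ρ ↦ δ_ρ X` on the dual of `V`, as the
continuous multilinear map `(ρ₁, …, ρ_k) ↦ (ρ₁ ⊗ ⋯ ⊗ ρ_k) Xₖ`. -/
def homogeneousPart (k : ℕ) (X : TensorSpace V) : (V →L[ℂ] ℂ) [×k]→L[ℂ] ℂ :=
  MultilinearMap.mkContinuous
    (((LinearMap.applyₗ (proj k X)).compMultilinearMap (tensorFunctional k)).compLinearMap
      fun _ => ContinuousLinearMap.coeLM (M := V) (N₃ := ℂ) (R := ℂ) ℂ)
    (tensorSeminorm (innerForm V) X / √(k ! : ℝ))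
    fun ρ => norm_tensorFunctional_proj_le k ρ X

theorem homogeneousPart_apply (k : ℕ) (X : TensorSpace V) (ρ : Fin k → V →L[ℂ] ℂ) :
    homogeneousPart k X ρ = tensorFunctional k (fun m => (ρ m : V →ₗ[ℂ] ℂ)) (proj k X) := rfl

theorem homogeneousPart_add (k : ℕ) (X Y : TensorSpace V) :
    homogeneousPart k (X + Y) = homogeneousPart k X + homogeneousPart k Y := by
  ext ρ
  simp only [add_apply, homogeneousPart_apply, map_add]

theorem norm_homogeneousPart_le (k : ℕ) (X : TensorSpace V) :
    ‖homogeneousPart k X‖ ≤ tensorSeminorm (innerForm V) X / √(k ! : ℝ) :=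
  MultilinearMap.mkContinuous_norm_le _ (div_nonneg (apply_nonneg _ _) (Real.sqrt_nonneg _))
    fun ρ => norm_tensorFunctional_proj_le k ρ X

theorem uniformContinuous_homogeneousPart (k : ℕ) :
    UniformContinuous (homogeneousPart (V := V) k) := by
  refine uniformContinuous_of_norm_le_tensorSeminorm (innerForm V)
    (AddMonoidHom.mk' (homogeneousPart k) (homogeneousPart_add k)) (√(k ! : ℝ))⁻¹ fun X => ?_
  rw [inv_mul_eq_div]
  exact norm_homogeneousPart_le k X

/-- The Taylor series at `0` of the function `ρ ↦ δ_ρ X` on the dual of `V`, for `X` in the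
completion of the symmetric tensors. -/
def evalSeries (X : SymTensorCpl V) : FormalMultilinearSeries ℂ (V →L[ℂ] ℂ) ℂ := fun k =>
  extendCpl (homogeneousPart (V := V) k) X

theorem evalSeries_coe (Y : SymTensor V) (k : ℕ) :
    evalSeries (Y : SymTensorCpl V) k = homogeneousPart k (Y : TensorSpace V) :=
  extendCpl_coe (uniformContinuous_homogeneousPart k) Y

theorem continuous_evalSeries (k : ℕ) : Continuous fun X : SymTensorCpl V => evalSeries X k :=
  continuous_extendCpl (homogeneousPart (V := V) k)

theorem norm_evalSeries_le (X : SymTensorCpl V) (k : ℕ) :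
    ‖evalSeries X k‖ ≤ extendCpl (tensorSeminorm (innerForm V)) X / √(k ! : ℝ) := by
  induction X using UniformSpace.Completion.induction_on with
  | hp =>
    have hnorm : Continuous fun X : SymTensorCpl V => ‖evalSeries X k‖ :=
      Continuous.norm (E := (V →L[ℂ] ℂ) [×k]→L[ℂ] ℂ) (continuous_evalSeries k)
    exact isClosed_le hnorm ((continuous_extendCpl _).div_const _)
  | ih Y =>
    rw [evalSeries_coe, extendCpl_coe (uniformContinuous_tensorSeminorm _)]
    exact norm_homogeneousPart_le k (Y : TensorSpace V)

theorem radius_evalSeries (X : SymTensorCpl V) : (evalSeries X).radius = ⊤ := by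
  refine (evalSeries X).radius_eq_top_of_summable_norm fun r => ?_
  refine Summable.of_nonneg_of_le (fun k => by positivity) (fun k => ?_)
    ((summable_pow_div_sqrt_factorial r).mul_left (extendCpl (tensorSeminorm (innerForm V)) X))
  rw [← mul_div_assoc, ← div_mul_eq_mul_div]
  gcongr
  exact norm_evalSeries_le X k

theorem hasSum_evalSeries (X : SymTensorCpl V) (ρ : V →L[ℂ] ℂ) :
    HasSum (fun k => evalSeries X k fun _ => ρ) (extendCpl (evalAt (ρ : V →ₗ[ℂ] ℂ)) X) := by
  refine hasSum_of_denseRange_of_norm_le UniformSpace.Completion.denseRange_coe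
    (f := fun k (X : SymTensorCpl V) => evalSeries X k fun _ => ρ)
    (B := extendCpl (tensorSeminorm (innerForm V))) (fun k => ?_) (continuous_extendCpl _)
    (continuous_extendCpl _) (summable_pow_div_sqrt_factorial ‖ρ‖) (fun k Y => ?_)
    (fun Y => ?_) X
  · exact (ContinuousMultilinearMap.apply ℂ (fun _ : Fin k => V →L[ℂ] ℂ) ℂ
      fun _ => ρ).continuous.comp (continuous_evalSeries k)
  · refine ((evalSeries _ k).le_of_opNorm_le (norm_evalSeries_le _ k) fun _ => ρ).trans_eq ?_
    rw [Fin.prod_const, div_mul_eq_mul_div, mul_div_assoc]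
  · simp only [evalSeries_coe, homogeneousPart_apply, extendCpl_coe (uniformContinuous_evalAt ρ)]
    exact hasSum_evalAt (ρ : V →ₗ[ℂ] ℂ) (Y : TensorSpace V)

theorem hasFPowerSeriesOnBall_extendCpl_evalAt (X : SymTensorCpl V) :
    HasFPowerSeriesOnBall (fun ρ : V →L[ℂ] ℂ => extendCpl (evalAt (ρ : V →ₗ[ℂ] ℂ)) X)
      (evalSeries X) 0 ⊤ where
  r_le := (radius_evalSeries X).ge
  r_pos := ENNReal.zero_lt_top
  hasSum {ρ} _ := by simpa only [zero_add] using hasSum_evalSeries X ρ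

theorem contDiff_extendCpl_evalAt (X : SymTensorCpl V) {n : WithTop ℕ∞} :
    ContDiff ℂ n fun ρ : V →L[ℂ] ℂ => extendCpl (evalAt (ρ : V →ₗ[ℂ] ℂ)) X := by
  have hana := (hasFPowerSeriesOnBall_extendCpl_evalAt X).analyticOnNhd
  rw [Metric.eball_top] at hana
  exact hana.contDiff

end PowerSeries

end HilbertTensor

theorem theorem4p2_general {V : Type*} [NormedAddCommGroup V] [InnerProductSpace ℂ V]
    (J : V →L⋆[ℂ] V) (X : HilbertTensor.SymTensorCpl V) {n : WithTop ℕ∞} :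
    ContDiff ℝ n (HilbertTensor.gelfand J X) := by
  have hincl : ContDiff ℝ n fun ρ : HilbertTensor.hermDual J => (ρ : V →L[ℂ] ℂ) :=
    ContinuousLinearMap.contDiff (𝕜 := ℝ) (E := HilbertTensor.hermDual J) (F := V →L[ℂ] ℂ)
      (HilbertTensor.hermDual J).subtypeL
  exact ((HilbertTensor.contDiff_extendCpl_evalAt X).restrict_scalars ℝ).comp hincl

/-- Let `V` be a complex Hilbert space with a continuous antilinear involution `J` that is
compatible with the inner product. Then the Gel'fand transform of every element of the completion
of the symmetric tensors is a smooth function, in the Fréchet sense, on the real Banach space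
`V'_h` of Hermitian continuous linear functionals. -/
theorem theorem4p2 {V : Type*} [NormedAddCommGroup V] [InnerProductSpace ℂ V] [CompleteSpace V]
    (J : V →L⋆[ℂ] V) (hJ : Function.Involutive J)
    (hJV : ∀ v w : V, (starRingEnd ℂ) (inner ℂ v w) = inner ℂ (J v) (J w))
    (X : HilbertTensor.SymTensorCpl V) :
    ContDiff ℝ ((⊤ : ℕ∞) : WithTop ℕ∞) (HilbertTensor.gelfand J X) :=
  theorem4p2_general J X
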